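/- Let $n\ge 1$ and $1<p,q<\infty$, and write $r'=r/(r-1)$ for $1<r<\infty$. Let $u,v$ be weights on $\mathbb{R}^n$ (nonnegative, locally integrable functions) such that $w=v^{-p'/p}$ is also locally integrable. For measurable $E\subset\mathbb{R}^n$ write $u(E)=\int_E u$, $v(E)=\int_E v$, $w(E)=\int_E w$, and let $|E|$ be the Lebesgue measure of $E$. Cubes are nondegenerate and have sides parallel to the coordinate axes. For $E\subset\mathbb{R}^n$ let $E^\circ=\{z: |x\cdot z|\le 1\text{ for all }x\in E\}$. Suppose $(u,v)\in N_{\mathcal Q}(p,q)$, that is, there is a constant $C$ such that $$u(Q)^{1/q}\,w((Q+\mu)^\circ+\tau)^{1/p'}\le C\quad\text{and}\quad u((Q+\mu)^\circ+\tau)^{1/q}\,w(Q)^{1/p'}\le C$$ for all cubes $Q$, all $\mu$ with $-\mu\in Q$, and all $\tau\in\mathbb{R}^n$. Put $s=\max\{p',q\}$. Then each of the following statements implies the next. (i) Either $p'\ge q$ and there is a constant $C$ such that $\frac{u(E)}{u(Q)}\le C\left(\frac{|E|}{|Q|}\right)^{q/p'}$ for all cubes $Q$ and all measurable $E\subset Q$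 (with $0/0=0$); or $p'\le q$ and there is a constant $C$ such that $\frac{|E|}{|Q|}\le C\left(\frac{v(E)}{v(Q)}\right)^{q'/p}$ for all cubes $Q$ and all measurable $E\subset Q$. (If $p'=q$, either of the two conditions suffices.) (ii) There is a constant $C$ such that for all bounded, measurable sets $E$ and $F$ with $|F|>0$, $$u(E)^{1/q}\le C\,|E|^{1/s}\,|F|^{-1/s'}\,v(F)^{1/p}.$$ (iii) If $s\ge 2$, the Fourier transform $\widehat f(z)=\int f(x)e^{-ix\cdot z}\,dx$ extends to the indicator functions $\chi_A$ of all measurable sets $A$ with $v(A)<\infty$, and is restricted weak-type $(p,q)$ with respect to $u$ and $v$. That is, for each such $A$ there is a function $\widehat\chi_A$ in $L^{q,\infty}(u)$, the space with quasinorm $\|f\|_{L^{q,\infty}(u)}=\sup_{\alpha>0}\alpha\,u(\{z:|f(z)|>\alpha\})^{1/q}$, such that $\|\widehat\chi_{A_j}-\widehat\chi_A\|_{L^{q,\infty}(u)}\to 0$ for every increasing sequence of bounded, measurable sets $A_j$ with union $A$ (where $\widehat\chi_{A_j}$ is the classical Fourier transform), and such that $\widehat\chi_A$ agrees $u$-almost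 everywhere with the classical Fourier transform if $|A|<\infty$; and there is a constant $C$ such that $$u(\{z:|\widehat\chi_A(z)|>\alpha\})^{1/q}\le\frac{C}{\alpha}\,v(A)^{1/p}$$ for all $\alpha>0$ and all measurable $A$ with $v(A)<\infty$. -/

import Mathlib

open MeasureTheory Filter Topology
open scoped ENNReal NNReal Pointwise

noncomputable section

namespace WeightedFourier

/-- Euclidean space `ℝⁿ`. -/
abbrev Rn (n : ℕ) : Type := EuclideanSpace ℝ (Fin n)

/-- A weight: a nonnegative, locally integrable function on `ℝⁿ`. -/
def IsWeight {n : ℕ} (u : Rn n → ℝ) : Prop :=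
  (∀ x, 0 ≤ u x) ∧ LocallyIntegrable u volume

/-- The measure `u(E) = ∫_E u(x) dx`. -/
def wMeasure {n : ℕ} (u : Rn n → ℝ) : Measure (Rn n) :=
  volume.withDensity fun x => ENNReal.ofReal (u x)

/-- The measure `w(E) = ∫_E v(x)^{-p'/p} dx`, where `p' = p / (p - 1)`. The power is taken in
`[0, ∞]`, so that the density is `∞` where `v` vanishes. -/
def dualMeasure {n : ℕ} (p : ℝ) (v : Rn n → ℝ) : Measure (Rn n) :=
  volume.withDensity fun x => ENNReal.ofReal (v x) ^ (-(p.conjExponent / p))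

/-- The closed cube with centre `c`, side length `2 * r` and sides parallel to the axes. -/
def cube {n : ℕ} (c : Rn n) (r : ℝ) : Set (Rn n) := {x | ∀ i, |x i - c i| ≤ r}

/-- The polar `E° = {z : |x · z| ≤ 1 for all x ∈ E}`. -/
def polarSet {n : ℕ} (E : Set (Rn n)) : Set (Rn n) := (innerₗ (Rn n)).polar E

/-- The class `N_𝒬(p,q)`; here `τ +ᵥ polarSet (μ +ᵥ Q)` is the set `(Q + μ)° + τ`. -/
def NQ {n : ℕ} (p q : ℝ) (u v : Rn n → ℝ) : Prop :=
  ∃ C : ℝ≥0, ∀ (c : Rn n) (r : ℝ), 0 < r → ∀ μ : Rn n, -μ ∈ cube c r → ∀ τ : Rn n,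
    wMeasure u (cube c r) ^ (1 / q) *
        dualMeasure p v (τ +ᵥ polarSet (μ +ᵥ cube c r)) ^ (1 / p.conjExponent) ≤ C ∧
    wMeasure u (τ +ᵥ polarSet (μ +ᵥ cube c r)) ^ (1 / q) *
        dualMeasure p v (cube c r) ^ (1 / p.conjExponent) ≤ C

/-- There is a constant `C` such that `μ₁(E) / μ₁(Q) ≤ C (μ₂(E) / μ₂(Q)) ^ δ` for all cubes `Q`
and all measurable `E ⊆ Q`. -/
def ComparableWith {n : ℕ} (μ₁ μ₂ : Measure (Rn n)) (δ : ℝ) : Prop :=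
  ∃ C : ℝ≥0, ∀ (c : Rn n) (r : ℝ), 0 < r → ∀ E : Set (Rn n), MeasurableSet E → E ⊆ cube c r →
    μ₁ E / μ₁ (cube c r) ≤ C * (μ₂ E / μ₂ (cube c r)) ^ δ

/-- The Fourier transform `f̂(z) = ∫ f(x) e^{-i x·z} dx`. -/
def fourierHat {n : ℕ} (f : Rn n → ℂ) (z : Rn n) : ℂ :=
  ∫ x, f x * Complex.exp (-(Complex.I * ((inner ℝ x z : ℝ) : ℂ)))

/-- The Fourier transform of the indicator function `χ_A`. -/
def indicatorHat {n : ℕ} (A : Set (Rn n)) : Rn n → ℂ :=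
  fourierHat (A.indicator fun _ => (1 : ℂ))

/-- The quasinorm `sup_{α > 0} α μ({z : |f(z)| > α})^{1/q}` of `L^{q,∞}(μ)`. -/
def weakQuasinorm {n : ℕ} (q : ℝ) (μ : Measure (Rn n)) (f : Rn n → ℂ) : ℝ≥0∞ :=
  ⨆ (α : ℝ≥0) (_ : 0 < α), (α : ℝ≥0∞) * μ {z | (α : ℝ) < ‖f z‖} ^ (1 / q)

/-- The map `T` extends the Fourier transform to the indicators `χ_A` of the measurable sets `A`
with `v(A) < ∞`, with values in `L^{q,∞}(u)`: `T A` is the `L^{q,∞}(u)`-limit of the Fourier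
transforms of `χ_{A_j}` for every sequence of bounded measurable sets `A_j` increasing to `A`,
and it is the classical Fourier transform `u`-almost everywhere whenever `χ_A` is integrable. -/
def ExtendsFourier {n : ℕ} (q : ℝ) (u v : Rn n → ℝ) (T : Set (Rn n) → Rn n → ℂ) : Prop :=
  ∀ A : Set (Rn n), MeasurableSet A → wMeasure v A < ∞ →
    AEStronglyMeasurable (T A) (wMeasure u) ∧
    weakQuasinorm q (wMeasure u) (T A) < ∞ ∧
    (volume A < ∞ → T A =ᵐ[wMeasure u] indicatorHat A) ∧
    ∀ B : ℕ → Set (Rn n), (∀ j, MeasurableSet (B j)) → (∀ j, Bornology.IsBounded (B j)) →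
      Monotone B → (⋃ j, B j) = A →
      Tendsto (fun j => weakQuasinorm q (wMeasure u) (fun z => indicatorHat (B j) z - T A z))
        atTop (𝓝 0)

end WeightedFourier

end

/-!
Throughout, `p'` is the conjugate exponent, `w = v^{-p'/p}` and `s = max p' q`.

**Comparability gives the two-set inequality.** Taking the polar of a cube `Q` after centring it at
the origin, `N_𝒬(p,q)` says that `u(Q)^{1/q} w(B)^{1/p'}` and `u(B)^{1/q} w(Q)^{1/p'}` are bounded
whenever `B` is a ball, placed anywhere, of radius reciprocal to the size of `Q`
(`NQ.exists_closedBall`); in that situation `|Q| |B|` is bounded below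
(`exists_inv_volume_cube_le`). Let `Q` grow, so that `B` shrinks.

If `q ≤ p'`, comparability gives `u(E)^{1/q} |Q|^{1/p'} ≲ u(Q)^{1/q} |E|^{1/p'}` for every large
`Q`, hence `u(E)^{1/q} w(B)^{1/p'} ≲ |E|^{1/p'} |B|^{1/p'}`. Lebesgue differentiation turns this
into a pointwise upper bound for `w`, that is, a lower bound for `v`, and integrating over `F` gives
the inequality. If `p' ≤ q`, comparability on `F ⊆ Q` and Hölder's inequality
`|Q| ≤ v(Q)^{1/p} w(Q)^{1/p'}` give `u(B)^{1/q} |F|^{1/q'} ≲ v(F)^{1/p} |B|^{1/q}`, hence a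
pointwise upper bound for `u`, which is integrated over `E`.

**The two-set inequality gives the restricted weak-type estimate.** By exhaustion the inequality
holds for unbounded sets (`mul_volume_le_of_bounded`). So, unless `u = 0` almost everywhere,
`v(A) < ∞` implies `|A| < ∞` (`volume_ne_top_of_mul_volume_le`), and the classical transform is
itself the extension. Plancherel's identity (`eLpNorm_fourier_eq`) and the trivial bound
`|χ̂_A| ≤ |A|` give `|{|χ̂_A| > α}| ≤ (2π)^n |A|^{s-1} α^{-s}` for `s ≥ 2`; inserting this level set
for `E` and `A` for `F` in the two-set inequality, the powers of `|A|` cancel. Continuity along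
`A_j ↑ A` is the same estimate applied to `A \ A_j`.
-/

/-! ### The Fourier transform of indicator functions -/

section Plancherel

open FourierTransform SchwartzMap

variable {V : Type*} [NormedAddCommGroup V] [InnerProductSpace ℝ V] [FiniteDimensional ℝ V]
  [MeasurableSpace V] [BorelSpace V]

/-- The Fourier integral of an integrable function is continuous. -/
theorem continuous_fourier_of_integrable {f : V → ℂ} (hf : Integrable f) : Continuous (𝓕 f) :=
  VectorFourier.fourierIntegral_continuous Real.continuous_fourierChar
    (by exact continuous_inner) hf

/-- On `L¹ ∩ L²` the Fourier integral is a representative of the `L²` Fourier transform. Both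
define the same tempered distribution: the first by moving the Fourier transform to the test
function, the second because the `L²` transform is compatible with that of `𝓢'`. -/
theorem fourier_ae_eq_fourier_toLp {f : V → ℂ} (h1 : Integrable f) (h2 : MemLp f 2) :
    𝓕 f =ᵐ[volume] (𝓕 (h2.toLp f) : Lp ℂ 2 (volume : Measure V)) := by
  set g : Lp ℂ 2 (volume : Measure V) := 𝓕 (h2.toLp f) with hg
  refine ae_eq_of_integral_contDiff_smul_eq (μ := volume)
    (continuous_fourier_of_integrable h1).locallyIntegrable
    ((Lp.memLp g).locallyIntegrable (by norm_num)) fun φ hφ hφc => ?_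
  have hc : HasCompactSupport fun x => (φ x : ℂ) := hφc.comp_left (g := fun t : ℝ => (t : ℂ)) rfl
  have hd : ContDiff ℝ (⊤ : ℕ∞) fun x => (φ x : ℂ) := Complex.ofRealCLM.contDiff.comp hφ
  let ψ : 𝓢(V, ℂ) := hc.toSchwartzMap hd
  have hψ : ∀ x, ψ x = (φ x : ℂ) := fun x => rfl
  have e1 : ∫ x, φ x • 𝓕 f x = ∫ x, 𝓕 (ψ : V → ℂ) x * f x := by
    have := VectorFourier.integral_fourierIntegral_smul_eq_flip (μ := (volume : Measure V))
      (ν := (volume : Measure V)) (L := innerₗ V)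
      Real.continuous_fourierChar (by exact continuous_inner) ψ.integrable h1
    rw [flip_innerₗ] at this
    refine Eq.trans ?_ this.symm
    simp only [hψ, Complex.real_smul, smul_eq_mul]
    rfl
  have e2 := congrArg (fun T => T ψ) (Lp.fourier_toTemperedDistribution_eq (h2.toLp f))
  simp only [TemperedDistribution.fourier_apply, Lp.toTemperedDistribution_apply] at e2
  rw [e1]
  refine Eq.trans ?_ (e2.trans ?_)
  · refine integral_congr_ae ?_
    filter_upwards [h2.coeFn_toLp] with x hx
    rw [hx, fourier_coe, smul_eq_mul]
  · simp only [hψ, Complex.real_smul, smul_eq_mul, hg]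

/-- Plancherel's identity for the Fourier integral of a function in `L¹ ∩ L²`. -/
theorem eLpNorm_fourier_eq {f : V → ℂ} (h1 : Integrable f) (h2 : MemLp f 2) :
    eLpNorm (𝓕 f) 2 volume = eLpNorm f 2 volume := by
  rw [eLpNorm_congr_ae (fourier_ae_eq_fourier_toLp h1 h2), ← eLpNorm_congr_ae h2.coeFn_toLp]
  have := Lp.norm_fourier_eq (h2.toLp f)
  rw [Lp.norm_def, Lp.norm_def] at this
  exact (ENNReal.toReal_eq_toReal_iff' (Lp.eLpNorm_ne_top _) (Lp.eLpNorm_ne_top _)).1 this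

end Plancherel

noncomputable section

namespace WeightedFourier

variable {n : ℕ}

open FourierTransform in
/-- The angular-frequency transform of the statement is a dilate of Mathlib's `𝓕`. -/
theorem fourierHat_eq_fourier (f : Rn n → ℂ) (z : Rn n) :
    fourierHat f z = 𝓕 f ((2 * Real.pi)⁻¹ • z) := by
  rw [Real.fourier_eq', fourierHat]
  congr 1
  ext x
  rw [real_inner_smul_right, smul_eq_mul, mul_comm]
  congr 2
  have : (Real.pi : ℂ) ≠ 0 := by exact_mod_cast Real.pi_ne_zero
  push_cast
  field_simp

theorem integrable_indicator_one {A : Set (Rn n)} (hA : MeasurableSet A) (hfin : volume A ≠ ∞) :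
    Integrable (A.indicator fun _ => (1 : ℂ)) :=
  (integrable_indicator_iff hA).2 (integrableOn_const hfin)

theorem continuous_indicatorHat {A : Set (Rn n)} (hA : MeasurableSet A) (hfin : volume A ≠ ∞) :
    Continuous (indicatorHat A) := by
  have : indicatorHat A = fun z => _ := funext (fourierHat_eq_fourier _)
  rw [this]
  exact (continuous_fourier_of_integrable (integrable_indicator_one hA hfin)).comp
    (continuous_const_smul _)

theorem enorm_indicatorHat_le {A : Set (Rn n)} (hA : MeasurableSet A) (z : Rn n) :
    ‖indicatorHat A z‖ₑ ≤ volume A := by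
  refine (enorm_integral_le_lintegral_enorm _).trans ?_
  rw [← lintegral_indicator_one hA]
  refine lintegral_mono fun x => ?_
  have h : ‖Complex.exp (-(Complex.I * ((inner ℝ x z : ℝ) : ℂ)))‖ₑ = 1 := by
    rw [← ofReal_norm, Complex.norm_exp]
    simp
  rw [enorm_mul, h, mul_one]
  by_cases hx : x ∈ A <;> simp [hx]

/-- Additivity of the transform on disjoint sets, in difference form. -/
theorem indicatorHat_sub {A B : Set (Rn n)} (hA : MeasurableSet A) (hB : MeasurableSet B)
    (hBA : B ⊆ A) (hfin : volume A ≠ ∞) (z : Rn n) :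
    indicatorHat B z - indicatorHat A z = -indicatorHat (A \ B) z := by
  have key : ∀ S : Set (Rn n), MeasurableSet S → volume S ≠ ∞ →
      Integrable fun x => S.indicator (fun _ => (1 : ℂ)) x *
        Complex.exp (-(Complex.I * ((inner ℝ x z : ℝ) : ℂ))) := by
    intro S hS hSf
    refine (integrable_indicator_one hS hSf).mul_bdd (c := 1) ?_ ?_
    · exact (by fun_prop : Continuous fun x : Rn n =>
        Complex.exp (-(Complex.I * ((inner ℝ x z : ℝ) : ℂ)))).aestronglyMeasurable
    · refine ae_of_all _ fun x => ?_
      rw [Complex.norm_exp]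
      simp
  have hBf : volume B ≠ ∞ := measure_ne_top_of_subset hBA hfin
  have hDf : volume (A \ B) ≠ ∞ := measure_ne_top_of_subset Set.sdiff_subset hfin
  have : indicatorHat A z = indicatorHat B z + indicatorHat (A \ B) z := by
    simp only [indicatorHat, fourierHat]
    rw [← integral_add (key B hB hBf) (key _ (hA.diff hB) hDf)]
    congr 1
    ext x
    rw [← add_mul]
    congr 1
    by_cases h1 : x ∈ A <;> by_cases h2 : x ∈ B <;> simp [h1, h2]
    exact absurd (hBA h2) h1
  rw [this]
  ring

open FourierTransform in
/-- `L²` bound for the Fourier transform of an indicator, as a distributional inequality. -/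
theorem sq_mul_volume_indicatorHat_le {A : Set (Rn n)} (hA : MeasurableSet A)
    (hfin : volume A ≠ ∞) (α : ℝ≥0) :
    (α : ℝ≥0∞) ^ (2 : ℝ) * volume {z | (α : ℝ) < ‖indicatorHat A z‖} ≤
      ENNReal.ofReal ((2 * Real.pi) ^ n) * volume A := by
  set f : Rn n → ℂ := A.indicator fun _ => (1 : ℂ) with hf
  have h1 : Integrable f := integrable_indicator_one hA hfin
  have h2 : MemLp f 2 := memLp_indicator_const 2 hA 1 (Or.inr hfin)
  have hpi : (0 : ℝ) < 2 * Real.pi := by positivity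
  have hset : {z | (α : ℝ) < ‖indicatorHat A z‖} =
      (fun z => (2 * Real.pi)⁻¹ • z) ⁻¹' {w | (α : ℝ) < ‖𝓕 f w‖} := by
    ext z
    simp only [Set.mem_ofPred_eq, Set.mem_preimage, indicatorHat, fourierHat_eq_fourier, hf]
  have hP : ∫⁻ w, ‖𝓕 f w‖ₑ ^ (2 : ℝ) = volume A := by
    have h := eLpNorm_fourier_eq h1 h2
    rw [hf, eLpNorm_indicator_const hA (by norm_num) (by norm_num), ← hf,
      eLpNorm_eq_lintegral_rpow_enorm_toReal (by norm_num) (by norm_num)] at h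
    simp only [ENNReal.toReal_ofNat, enorm_one, one_mul] at h
    exact ENNReal.rpow_left_injective (by norm_num : (1 / 2 : ℝ) ≠ 0) h
  have hcheb : (α : ℝ≥0∞) ^ (2 : ℝ) * volume {w | (α : ℝ) < ‖𝓕 f w‖} ≤ volume A := by
    rw [← hP]
    refine le_trans ?_ (mul_meas_ge_le_lintegral₀
      ((continuous_fourier_of_integrable h1).enorm.measurable.pow_const _).aemeasurable ((α : ℝ≥0∞) ^ (2 : ℝ)))
    gcongr with w
    intro hw
    refine ENNReal.rpow_le_rpow ?_ (by norm_num)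
    rw [enorm_eq_nnnorm]
    exact_mod_cast (show (α : ℝ) ≤ ‖𝓕 f w‖ from le_of_lt hw)
  rw [hset, Measure.addHaar_preimage_smul _ (inv_ne_zero hpi.ne'), finrank_euclideanSpace_fin,
    inv_pow, inv_inv, abs_of_pos (by positivity), mul_left_comm]
  gcongr

/-- The restricted weak-type Hausdorff–Young inequality. For `s ≥ 2` it follows from the `L²`
bound, because `α` may be taken below the trivial bound `|A|` of the transform. -/
theorem rpow_mul_volume_indicatorHat_le {A : Set (Rn n)} (hA : MeasurableSet A)
    (hfin : volume A ≠ ∞) {s : ℝ} (hs : 2 ≤ s) (α : ℝ≥0) :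
    (α : ℝ≥0∞) ^ s * volume {z | (α : ℝ) < ‖indicatorHat A z‖} ≤
      ENNReal.ofReal ((2 * Real.pi) ^ n) * volume A ^ (s - 1) := by
  by_cases hα : (α : ℝ≥0∞) ≤ volume A
  · calc (α : ℝ≥0∞) ^ s * volume {z | (α : ℝ) < ‖indicatorHat A z‖}
        = (α : ℝ≥0∞) ^ (s - 2) *
          ((α : ℝ≥0∞) ^ (2 : ℝ) * volume {z | (α : ℝ) < ‖indicatorHat A z‖}) := by
          rw [← mul_assoc, ← ENNReal.rpow_add_of_nonneg _ _ (by linarith) (by norm_num)]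
          congr 2
          ring
      _ ≤ volume A ^ (s - 2) * (ENNReal.ofReal ((2 * Real.pi) ^ n) * volume A) :=
          mul_le_mul' (ENNReal.rpow_le_rpow hα (by linarith))
            (sq_mul_volume_indicatorHat_le hA hfin α)
      _ = ENNReal.ofReal ((2 * Real.pi) ^ n) * volume A ^ (s - 1) := by
          rw [mul_left_comm]
          congr 1
          conv_lhs => rw [← ENNReal.rpow_one (volume A), ← ENNReal.rpow_mul, one_mul]
          rw [← ENNReal.rpow_add_of_nonneg _ _ (by linarith) (by norm_num)]
          congr 1
          ring
  · have : {z | (α : ℝ) < ‖indicatorHat A z‖} = ∅ := by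
      refine Set.eq_empty_of_forall_notMem fun z hz => hα ?_
      refine le_trans ?_ (enorm_indicatorHat_le hA z)
      rw [enorm_eq_nnnorm]
      exact_mod_cast (show (α : ℝ) ≤ ‖indicatorHat A z‖ from le_of_lt hz)
    rw [this]
    simp

/-! ### From the inequality for bounded sets to the restricted weak-type estimate -/

/-- Exhaustion by balls removes the boundedness assumptions from a two-set inequality. Moving
`|F|` to the left-hand side makes the form meaningful for sets of measure zero or infinity. -/
theorem mul_volume_le_of_bounded {μ ν : Measure (Rn n)} {C : ℝ≥0} {a b c d : ℝ}
    (ha : 0 < a) (hb : 0 < b) (hc : 0 < c) (hd : 0 < d)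
    (h : ∀ E F : Set (Rn n), MeasurableSet E → Bornology.IsBounded E → MeasurableSet F →
      Bornology.IsBounded F → volume F ≠ 0 →
      μ E ^ c ≤ C * volume E ^ a * volume F ^ (-b) * ν F ^ d)
    {E F : Set (Rn n)} (hE : MeasurableSet E) (hF : MeasurableSet F) :
    μ E ^ c * volume F ^ b ≤ C * volume E ^ a * ν F ^ d := by
  have hexh : ∀ (ρ : Measure (Rn n)) (S : Set (Rn n)),
      Tendsto (fun k : ℕ => ρ (S ∩ Metric.closedBall 0 k)) atTop (𝓝 (ρ S)) := by
    intro ρ S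
    have := tendsto_measure_iUnion_atTop (μ := ρ) (s := fun k : ℕ => S ∩ Metric.closedBall 0 k)
      (fun i j hij => Set.inter_subset_inter_right _
        (Metric.closedBall_subset_closedBall (by exact_mod_cast hij)))
    rwa [← Set.inter_iUnion, Metric.iUnion_closedBall_nat, Set.inter_univ] at this
  have hk : ∀ k : ℕ, μ (E ∩ Metric.closedBall 0 k) ^ c * volume (F ∩ Metric.closedBall 0 k) ^ b ≤
      C * volume E ^ a * ν F ^ d := by
    intro k
    set Fk := F ∩ Metric.closedBall (0 : Rn n) k
    rcases eq_or_ne (volume Fk) 0 with h0 | h0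
    · rw [h0, ENNReal.zero_rpow_of_pos hb, mul_zero]
      exact zero_le
    have hbdd : ∀ S : Set (Rn n), Bornology.IsBounded (S ∩ Metric.closedBall (0 : Rn n) k) :=
      fun S => Metric.isBounded_closedBall.subset Set.inter_subset_right
    have hm : ∀ S : Set (Rn n), MeasurableSet S →
        MeasurableSet (S ∩ Metric.closedBall (0 : Rn n) k) :=
      fun S hS => hS.inter Metric.isClosed_closedBall.measurableSet
    have hfin : volume Fk ≠ ∞ := (hbdd F).measure_lt_top.ne
    have h1 := h _ _ (hm E hE) (hbdd E) (hm F hF) (hbdd F) h0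
    calc μ (E ∩ Metric.closedBall 0 k) ^ c * volume Fk ^ b
        ≤ (C * volume (E ∩ Metric.closedBall 0 k) ^ a * volume Fk ^ (-b) * ν Fk ^ d)
            * volume Fk ^ b := by gcongr
      _ = (volume Fk ^ (-b) * volume Fk ^ b) *
            (C * volume (E ∩ Metric.closedBall 0 k) ^ a * ν Fk ^ d) := by ring
      _ = C * volume (E ∩ Metric.closedBall 0 k) ^ a * ν Fk ^ d := by
          rw [← ENNReal.rpow_add _ _ h0 hfin, neg_add_cancel, ENNReal.rpow_zero, one_mul]
      _ ≤ C * volume E ^ a * ν F ^ d := by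
          gcongr
          · exact Set.inter_subset_left
          · exact Set.inter_subset_left
  -- The product of the limits is the limit of the products unless it has the form `0 * ∞`.
  rcases eq_or_ne (μ E) 0 with hE0 | hE0
  · rw [hE0, ENNReal.zero_rpow_of_pos hc, zero_mul]
    exact zero_le
  rcases eq_or_ne (volume F) 0 with hF0 | hF0
  · rw [hF0, ENNReal.zero_rpow_of_pos hb, mul_zero]
    exact zero_le
  refine le_of_tendsto' (ENNReal.Tendsto.mul
    ((ENNReal.continuous_rpow_const.tendsto _).comp (hexh μ E)) (Or.inl ?_)
    ((ENNReal.continuous_rpow_const.tendsto _).comp (hexh volume F)) (Or.inl ?_)) hk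
  · simp [ENNReal.rpow_eq_zero_iff, hE0, hc.le]
  · simp [ENNReal.rpow_eq_zero_iff, hF0, hb.le]

/-- If the two-set inequality holds and `μ` is not zero, then sets of finite `ν`-measure have
finite Lebesgue measure: take for `E` a ball of positive `μ`-measure. -/
theorem volume_ne_top_of_mul_volume_le {μ ν : Measure (Rn n)} {C : ℝ≥0} {a b c d : ℝ}
    (ha : 0 < a) (hb : 0 < b) (hc : 0 < c) (hd : 0 < d)
    (h : ∀ E F : Set (Rn n), MeasurableSet E → MeasurableSet F →
      μ E ^ c * volume F ^ b ≤ C * volume E ^ a * ν F ^ d)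
    (hμ : μ ≠ 0) {A : Set (Rn n)} (hA : MeasurableSet A) (hν : ν A < ∞) : volume A ≠ ∞ := by
  obtain ⟨k, hk⟩ : ∃ k : ℕ, μ (Metric.closedBall 0 k) ≠ 0 := by
    by_contra! hall
    refine hμ (Measure.measure_univ_eq_zero.1 ?_)
    rw [← Metric.iUnion_closedBall_nat (0 : Rn n)]
    exact measure_iUnion_null hall
  intro htop
  have h1 := h (Metric.closedBall 0 k) A Metric.isClosed_closedBall.measurableSet hA
  rw [htop, ENNReal.top_rpow_of_pos hb, ENNReal.mul_top
    (by simp [ENNReal.rpow_eq_zero_iff, hk, hc.le]), top_le_iff] at h1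
  refine ENNReal.mul_ne_top (ENNReal.mul_ne_top ENNReal.coe_ne_top ?_) ?_ h1
  · exact ENNReal.rpow_ne_top_of_nonneg ha.le Metric.isBounded_closedBall.measure_lt_top.ne
  · exact ENNReal.rpow_ne_top_of_nonneg hd.le hν.ne

/-- The restricted weak-type estimate for sets of finite measure: apply the two-set inequality to
`F = A` and the level set `E = {|χ̂_A| > α}`, whose measure is controlled by the restricted
weak-type Hausdorff–Young inequality. -/
theorem mul_measure_indicatorHat_le {μ ν : Measure (Rn n)} {C : ℝ≥0} {s c d : ℝ}
    (hs : 2 ≤ s) (hc : 0 < c)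
    (h : ∀ E F : Set (Rn n), MeasurableSet E → MeasurableSet F →
      μ E ^ c * volume F ^ (1 / s.conjExponent) ≤ C * volume E ^ (1 / s) * ν F ^ d)
    {A : Set (Rn n)} (hA : MeasurableSet A) (hfin : volume A ≠ ∞) (α : ℝ≥0) :
    (α : ℝ≥0∞) * μ {z | (α : ℝ) < ‖indicatorHat A z‖} ^ c ≤
      C * ENNReal.ofReal ((2 * Real.pi) ^ n) ^ (1 / s) * ν A ^ d := by
  have hs0 : 0 < s := by linarith
  have hb : 1 / s.conjExponent = (s - 1) * (1 / s) := by
    rw [Real.conjExponent]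
    field_simp
  have hb0 : 0 < 1 / s.conjExponent := by
    rw [hb]
    have : 0 < s - 1 := by linarith
    positivity
  set E := {z | (α : ℝ) < ‖indicatorHat A z‖} with hEdef
  rcases eq_or_ne (volume A) 0 with h0 | h0
  · have : E = ∅ := by
      refine Set.eq_empty_of_forall_notMem fun z hz => ?_
      have h1 := enorm_indicatorHat_le hA z
      rw [h0, nonpos_iff_eq_zero, enorm_eq_zero] at h1
      have h2 : (α : ℝ) < ‖indicatorHat A z‖ := hz
      rw [h1, norm_zero] at h2
      exact absurd h2 (not_lt.2 α.2)
    rw [this, measure_empty, ENNReal.zero_rpow_of_pos hc, mul_zero]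
    exact zero_le
  have hE : MeasurableSet E :=
    measurableSet_lt measurable_const (continuous_indicatorHat hA hfin).norm.measurable
  have hHY : (α : ℝ≥0∞) * volume E ^ (1 / s) ≤
      ENNReal.ofReal ((2 * Real.pi) ^ n) ^ (1 / s) * volume A ^ (1 / s.conjExponent) := by
    have h1 := ENNReal.rpow_le_rpow (rpow_mul_volume_indicatorHat_le hA hfin hs α)
      (by positivity : 0 ≤ 1 / s)
    rwa [ENNReal.mul_rpow_of_nonneg _ _ (by positivity), ENNReal.mul_rpow_of_nonneg _ _
      (by positivity), ← ENNReal.rpow_mul, ← ENNReal.rpow_mul, mul_one_div_cancel hs0.ne',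
      ENNReal.rpow_one, ← hb] at h1
  have hX0 : volume A ^ (1 / s.conjExponent) ≠ 0 := by
    simp [ENNReal.rpow_eq_zero_iff, h0, hfin]
  have hXt : volume A ^ (1 / s.conjExponent) ≠ ∞ :=
    ENNReal.rpow_ne_top_of_nonneg hb0.le hfin
  refine (ENNReal.mul_le_mul_iff_left hX0 hXt).1 ?_
  calc (α : ℝ≥0∞) * μ E ^ c * volume A ^ (1 / s.conjExponent)
      = α * (μ E ^ c * volume A ^ (1 / s.conjExponent)) := mul_assoc _ _ _
    _ ≤ α * (C * volume E ^ (1 / s) * ν A ^ d) := by gcongr α * ?_; exact h E A hE hA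
    _ = (α * volume E ^ (1 / s)) * (C * ν A ^ d) := by ring
    _ ≤ (ENNReal.ofReal ((2 * Real.pi) ^ n) ^ (1 / s) * volume A ^ (1 / s.conjExponent)) *
          (C * ν A ^ d) := by gcongr
    _ = _ := by ring

/-- The classical transform of indicators is already the required extension: unless `u = 0`
almost everywhere, every set with `v(A) < ∞` has finite Lebesgue measure. -/
theorem exists_extendsFourier {p q : ℝ} (hp : 1 < p) (hq : 1 < q) {u v : Rn n → ℝ} {s : ℝ}
    (hs : 2 ≤ s) {C : ℝ≥0}
    (h : ∀ E F : Set (Rn n), MeasurableSet E → Bornology.IsBounded E → MeasurableSet F →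
      Bornology.IsBounded F → volume F ≠ 0 →
      wMeasure u E ^ (1 / q) ≤ C * volume E ^ (1 / s) * volume F ^ (-(1 / s.conjExponent)) *
        wMeasure v F ^ (1 / p)) :
    ∃ T : Set (Rn n) → Rn n → ℂ, ExtendsFourier q u v T ∧
      ∃ C : ℝ≥0, ∀ A : Set (Rn n), MeasurableSet A → wMeasure v A < ∞ → ∀ α : ℝ≥0, 0 < α →
        wMeasure u {z | (α : ℝ) < ‖T A z‖} ^ (1 / q) ≤
          ((C / α : ℝ≥0) : ℝ≥0∞) * wMeasure v A ^ (1 / p) := by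
  have hp0 : 0 < 1 / p := by positivity
  have hq0 : 0 < 1 / q := by positivity
  have hs0 : 0 < 1 / s := by positivity
  have hb0 : 0 < 1 / s.conjExponent :=
    one_div_pos.2 (Real.HolderConjugate.conjExponent (by linarith)).symm.pos
  have hg : ∀ E F : Set (Rn n), MeasurableSet E → MeasurableSet F →
      wMeasure u E ^ (1 / q) * volume F ^ (1 / s.conjExponent) ≤
        C * volume E ^ (1 / s) * wMeasure v F ^ (1 / p) :=
    fun E F hE hF => mul_volume_le_of_bounded hs0 hb0 hq0 hp0 h hE hF
  have hfin : wMeasure u ≠ 0 → ∀ A : Set (Rn n), MeasurableSet A → wMeasure v A < ∞ →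
      volume A ≠ ∞ :=
    fun hu0 A hA hvA => volume_ne_top_of_mul_volume_le hs0 hb0 hq0 hp0 hg hu0 hA hvA
  set D : ℝ≥0 := C * ((2 * Real.pi) ^ n).toNNReal ^ (1 / s) with hD
  have hDcoe : (D : ℝ≥0∞) = C * ENNReal.ofReal ((2 * Real.pi) ^ n) ^ (1 / s) := by
    rw [hD, ENNReal.coe_mul, ENNReal.coe_rpow_of_nonneg _ hs0.le]
    rfl
  have hweak : ∀ A : Set (Rn n), MeasurableSet A → wMeasure v A < ∞ → ∀ α : ℝ≥0, 0 < α →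
      (α : ℝ≥0∞) * wMeasure u {z | (α : ℝ) < ‖indicatorHat A z‖} ^ (1 / q) ≤
        D * wMeasure v A ^ (1 / p) := by
    intro A hA hvA α hα
    rcases eq_or_ne (wMeasure u) 0 with hu0 | hu0
    · simp [hu0, (by linarith : 0 < q)]
    · rw [hDcoe]
      exact mul_measure_indicatorHat_le hs hq0 hg hA (hfin hu0 A hA hvA) α
  have hquasi : ∀ A : Set (Rn n), MeasurableSet A → wMeasure v A < ∞ →
      weakQuasinorm q (wMeasure u) (indicatorHat A) ≤ D * wMeasure v A ^ (1 / p) :=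
    fun A hA hvA => iSup₂_le fun α hα => hweak A hA hvA α hα
  refine ⟨indicatorHat, fun A hA hvA => ⟨?_, ?_, fun _ => EventuallyEq.rfl, ?_⟩, D,
    fun A hA hvA α hα => ?_⟩
  · rcases eq_or_ne (wMeasure u) 0 with hu0 | hu0
    · rw [hu0]
      exact aestronglyMeasurable_zero_measure _
    · exact (continuous_indicatorHat hA (hfin hu0 A hA hvA)).aestronglyMeasurable
  · exact (hquasi A hA hvA).trans_lt (ENNReal.mul_lt_top ENNReal.coe_lt_top
      (ENNReal.rpow_lt_top_of_nonneg hp0.le hvA.ne))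
  · intro B hB _ hmono hU
    rcases eq_or_ne (wMeasure u) 0 with hu0 | hu0
    · have : ∀ f : Rn n → ℂ, weakQuasinorm q (wMeasure u) f = 0 := fun f => by
        simp [weakQuasinorm, hu0, (by linarith : 0 < q)]
      simp only [this]
      exact tendsto_const_nhds
    have hAf := hfin hu0 A hA hvA
    have hBA : ∀ j, B j ⊆ A := fun j => hU ▸ Set.subset_iUnion B j
    -- the error is the transform of `A \ B j` up to sign, and `v(A \ B j) → 0`
    have hle : ∀ j, weakQuasinorm q (wMeasure u) (fun z => indicatorHat (B j) z - indicatorHat A z)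
        ≤ D * wMeasure v (A \ B j) ^ (1 / p) := by
      intro j
      have : weakQuasinorm q (wMeasure u) (fun z => indicatorHat (B j) z - indicatorHat A z) =
          weakQuasinorm q (wMeasure u) (indicatorHat (A \ B j)) := by
        simp only [weakQuasinorm, indicatorHat_sub hA (hB j) (hBA j) hAf, norm_neg]
      rw [this]
      exact hquasi _ (hA.diff (hB j)) ((measure_mono Set.sdiff_subset).trans_lt hvA)
    have hdiff : Tendsto (fun j => wMeasure v (A \ B j)) atTop (𝓝 0) := by
      have := tendsto_measure_iInter_atTop (μ := wMeasure v) (s := fun j => A \ B j)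
        (fun j => (hA.diff (hB j)).nullMeasurableSet)
        (fun i j hij => Set.sdiff_subset_sdiff_right (hmono hij))
        ⟨0, ((measure_mono Set.sdiff_subset).trans_lt hvA).ne⟩
      rwa [← Set.sdiff_iUnion, hU, sdiff_self, Set.bot_eq_empty, measure_empty] at this
    have hlim : Tendsto (fun j => (D : ℝ≥0∞) * wMeasure v (A \ B j) ^ (1 / p)) atTop (𝓝 0) := by
      have := ENNReal.Tendsto.const_mul (a := (D : ℝ≥0∞))
        ((ENNReal.continuous_rpow_const (y := 1 / p)).tendsto _ |>.comp hdiff)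
        (Or.inr ENNReal.coe_ne_top)
      rwa [ENNReal.zero_rpow_of_pos hp0, mul_zero] at this
    exact tendsto_of_tendsto_of_tendsto_of_le_of_le tendsto_const_nhds hlim
      (fun j => zero_le) hle
  · rw [ENNReal.coe_div hα.ne', ENNReal.mul_comm_div, ← mul_div_assoc]
    rw [ENNReal.le_div_iff_mul_le (Or.inl (by exact_mod_cast hα.ne'))
      (Or.inl ENNReal.coe_ne_top), mul_comm]
    exact hweak A hA hvA α hα

/-! ### Cubes, their polars, and small balls -/

/-- The Euclidean norm is at most the `ℓ¹` norm. -/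
theorem norm_le_sum_norm_coord (x : Rn n) : ‖x‖ ≤ ∑ i, ‖x i‖ := by
  rw [EuclideanSpace.norm_eq]
  exact Real.sqrt_le_left (Finset.sum_nonneg fun i _ => norm_nonneg _) |>.2
    (Finset.sum_sq_le_sq_sum_of_nonneg fun i _ => norm_nonneg _)

theorem closedBall_subset_cube (c : Rn n) (r : ℝ) : Metric.closedBall c r ⊆ cube c r := by
  intro x hx i
  have h := PiLp.norm_apply_le (x - c) i
  rw [← dist_eq_norm] at h
  simpa [Real.norm_eq_abs] using h.trans hx

theorem isBounded_cube (c : Rn n) (r : ℝ) : Bornology.IsBounded (cube c r) := by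
  refine (Metric.isBounded_iff_subset_closedBall c).2 ⟨∑ _i : Fin n, r, fun x hx => ?_⟩
  rw [Metric.mem_closedBall, dist_eq_norm]
  refine (norm_le_sum_norm_coord (x - c)).trans (Finset.sum_le_sum fun i _ => ?_)
  simpa [Real.norm_eq_abs] using hx i

theorem measurableSet_cube (c : Rn n) (r : ℝ) : MeasurableSet (cube c r) := by
  have : cube c r = ⋂ i, {x : Rn n | |x i - c i| ≤ r} := by
    ext x
    simp [cube]
  rw [this]
  exact MeasurableSet.iInter fun i =>
    (isClosed_le (by fun_prop) continuous_const).measurableSet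

theorem volume_cube_ne_zero (c : Rn n) {r : ℝ} (hr : 0 < r) : volume (cube c r) ≠ 0 :=
  fun h0 => (Metric.measure_closedBall_pos volume c hr).ne'
    (measure_mono_null (closedBall_subset_cube c r) h0)

/-- The polar of a cube centred at the origin contains a ball of the reciprocal radius. -/
theorem closedBall_subset_polarSet (hn : 0 < n) (c : Rn n) {δ : ℝ} (hδ : 0 < δ) :
    Metric.closedBall 0 δ ⊆ polarSet (-c +ᵥ cube c (1 / (n * δ))) := by
  intro z hz
  rw [mem_closedBall_zero_iff] at hz
  rw [polarSet, LinearMap.polar_mem_iff]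
  rintro _ ⟨x, hx, rfl⟩
  have hn' : (0 : ℝ) < n := by exact_mod_cast hn
  have hx' : ‖-c + x‖ ≤ n * (1 / (n * δ)) := by
    refine (norm_le_sum_norm_coord (-c + x)).trans ?_
    refine (Finset.sum_le_sum (g := fun _ => 1 / (n * δ)) fun i _ => ?_).trans_eq (by simp)
    have := hx i
    rwa [sub_eq_neg_add, ← Real.norm_eq_abs] at this
  simp only [vadd_eq_add, innerₗ_apply_apply]
  calc ‖inner ℝ (-c + x) z‖ ≤ ‖-c + x‖ * ‖z‖ := norm_inner_le_norm _ _
    _ ≤ n * (1 / (n * δ)) * δ := by gcongr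
    _ = 1 := by field_simp

/-- The condition `N_𝒬(p,q)` in the only form that is needed: the cube is translated to the origin
before taking the polar, and the polar is replaced by a ball. -/
theorem NQ.exists_closedBall (hn : 0 < n) {p q : ℝ} (hp : 1 < p) (hq : 1 < q) {u v : Rn n → ℝ}
    (h : NQ p q u v) :
    ∃ C : ℝ≥0, ∀ (c τ : Rn n) (δ : ℝ), 0 < δ →
      wMeasure u (cube c (1 / (n * δ))) ^ (1 / q) *
        dualMeasure p v (Metric.closedBall τ δ) ^ (1 / p.conjExponent) ≤ C ∧
      wMeasure u (Metric.closedBall τ δ) ^ (1 / q) *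
        dualMeasure p v (cube c (1 / (n * δ))) ^ (1 / p.conjExponent) ≤ C := by
  obtain ⟨C, hC⟩ := h
  have hp' : 0 < p.conjExponent := (Real.HolderConjugate.conjExponent hp).symm.pos
  refine ⟨C, fun c τ δ hδ => ?_⟩
  have hr : 0 < 1 / (n * δ) := by positivity
  have hc : -(-c) ∈ cube c (1 / (n * δ)) := by
    rw [neg_neg]
    intro i
    simpa using hr.le
  have hsub : Metric.closedBall τ δ ⊆ τ +ᵥ polarSet (-c +ᵥ cube c (1 / (n * δ))) := by
    have := Set.vadd_set_mono (a := τ) (closedBall_subset_polarSet hn c hδ)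
    rwa [Metric.vadd_closedBall, vadd_eq_add, add_zero] at this
  obtain ⟨h1, h2⟩ := hC c _ hr (-c) hc τ
  constructor
  · refine le_trans ?_ h1
    gcongr
  · refine le_trans ?_ h2
    gcongr

/-- A cube and a ball of reciprocal size have reciprocal volumes, up to a constant. -/
theorem exists_inv_volume_cube_le (hn : 0 < n) :
    ∃ κ : ℝ≥0, ∀ (c τ : Rn n) (δ : ℝ), 0 < δ →
      (volume (cube c (1 / (n * δ))))⁻¹ ≤ κ * volume (Metric.closedBall τ δ) := by
  set ω := volume (Metric.ball (0 : Rn n) 1) with hω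
  have hω0 : ω ≠ 0 := (Metric.measure_ball_pos volume _ one_pos).ne'
  have hωt : ω ≠ ∞ := measure_ball_lt_top.ne
  have hn' : (0 : ℝ) < n := by exact_mod_cast hn
  have hκ : (ENNReal.ofReal ((n : ℝ) ^ n) * (ω * ω)⁻¹) ≠ ∞ :=
    ENNReal.mul_ne_top ENNReal.ofReal_ne_top (ENNReal.inv_ne_top.2 (mul_ne_zero hω0 hω0))
  refine ⟨(ENNReal.ofReal ((n : ℝ) ^ n) * (ω * ω)⁻¹).toNNReal, fun c τ δ hδ => ?_⟩
  rw [ENNReal.coe_toNNReal hκ]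
  have hr : 0 < 1 / (n * δ) := by positivity
  calc (volume (cube c (1 / (n * δ))))⁻¹
      ≤ (volume (Metric.closedBall c (1 / (n * δ))))⁻¹ :=
        ENNReal.inv_le_inv.2 (measure_mono (closedBall_subset_cube _ _))
    _ = ENNReal.ofReal ((n * δ) ^ n) * ω⁻¹ := by
        rw [Measure.addHaar_closedBall _ _ hr.le, finrank_euclideanSpace_fin,
          ENNReal.mul_inv (Or.inr hωt) (Or.inr hω0), ← ENNReal.ofReal_inv_of_pos (by positivity),
          one_div, inv_pow, inv_inv]
    _ = ENNReal.ofReal ((n : ℝ) ^ n) * (ω * ω)⁻¹ * (ENNReal.ofReal (δ ^ n) * ω) := by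
        rw [mul_pow, ENNReal.ofReal_mul (by positivity),
          ENNReal.mul_inv (Or.inl hω0) (Or.inl hωt)]
        calc _ = ENNReal.ofReal ((n : ℝ) ^ n) * ENNReal.ofReal (δ ^ n) * ω⁻¹ * 1 := by ring
          _ = ENNReal.ofReal ((n : ℝ) ^ n) * ENNReal.ofReal (δ ^ n) * ω⁻¹ * (ω⁻¹ * ω) := by
            rw [ENNReal.inv_mul_cancel hω0 hωt]
          _ = _ := by ring
    _ = _ := by
        rw [Measure.addHaar_closedBall _ _ hδ.le, finrank_euclideanSpace_fin]

/-- A bounded set lies in the cubes at the origin whose reciprocal size is small. -/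
theorem eventually_subset_cube (hn : 0 < n) {E : Set (Rn n)} (hE : Bornology.IsBounded E) :
    ∀ᶠ δ : ℝ in 𝓝[>] 0, E ⊆ cube 0 (1 / (n * δ)) := by
  obtain ⟨R, hR⟩ := (Metric.isBounded_iff_subset_closedBall 0).1 hE
  have hn' : (0 : ℝ) < n := by exact_mod_cast hn
  have hlim : Tendsto (fun δ : ℝ => 1 / (n * δ)) (𝓝[>] 0) atTop := by
    have := (tendsto_inv_nhdsGT_zero (𝕜 := ℝ)).const_mul_atTop (inv_pos.2 hn')
    refine this.congr fun δ => ?_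
    rw [one_div, mul_inv]
  filter_upwards [hlim.eventually_ge_atTop R] with δ hδ
  exact (hR.trans (Metric.closedBall_subset_closedBall hδ)).trans (closedBall_subset_cube _ _)

/-! ### Weights as locally finite measures -/

/-- Lebesgue differentiation: a density whose averages over all sufficiently small balls are at
most `M` is at most `M` almost everywhere. -/
theorem ae_le_of_eventually_closedBall_le {f : Rn n → ℝ≥0∞} (hf : AEMeasurable f volume)
    [IsLocallyFiniteMeasure (volume.withDensity f)] {M : ℝ≥0∞}
    (h : ∀ᶠ δ : ℝ in 𝓝[>] 0, ∀ τ : Rn n, volume.withDensity f (Metric.closedBall τ δ) ≤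
      M * volume (Metric.closedBall τ δ)) :
    ∀ᵐ x, f x ≤ M := by
  filter_upwards [Besicovitch.ae_tendsto_rnDeriv (volume.withDensity f) volume,
    Measure.rnDeriv_withDensity₀ volume hf] with x hx hfx
  rw [hfx] at hx
  refine le_of_tendsto hx ?_
  filter_upwards [h] with δ hδ
  exact ENNReal.div_le_of_le_mul (hδ x)

theorem isLocallyFiniteMeasure_of_compact {μ : Measure (Rn n)}
    (h : ∀ K : Set (Rn n), IsCompact K → μ K < ∞) : IsLocallyFiniteMeasure μ :=
  haveI : IsFiniteMeasureOnCompacts μ := ⟨fun {K} hK => h K hK⟩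
  isLocallyFiniteMeasure_of_isFiniteMeasureOnCompacts

theorem IsWeight.aemeasurable {u : Rn n → ℝ} (hu : IsWeight u) :
    AEMeasurable (fun x => ENNReal.ofReal (u x)) volume :=
  hu.2.aestronglyMeasurable.aemeasurable.ennreal_ofReal

theorem IsWeight.isLocallyFiniteMeasure {u : Rn n → ℝ} (hu : IsWeight u) :
    IsLocallyFiniteMeasure (wMeasure u) := by
  refine isLocallyFiniteMeasure_of_compact fun K hK => ?_
  rw [wMeasure, withDensity_apply _ hK.measurableSet]
  exact (hu.2.integrableOn_isCompact hK).lintegral_lt_top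

/-- Local integrability of `v^{-p'/p}` forces `v > 0` almost everywhere. -/
theorem ae_ofReal_ne_zero_of_dualMeasure {p : ℝ} (hp : 1 < p) {v : Rn n → ℝ} (hv : IsWeight v)
    (hw : ∀ K : Set (Rn n), IsCompact K → dualMeasure p v K < ∞) :
    ∀ᵐ x, ENNReal.ofReal (v x) ≠ 0 := by
  have ht : 0 < p.conjExponent / p :=
    div_pos (Real.HolderConjugate.conjExponent hp).symm.pos (by linarith)
  have key : ∀ k : ℕ, ∀ᵐ x ∂volume.restrict (Metric.closedBall (0 : Rn n) k),
      ENNReal.ofReal (v x) ≠ 0 := by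
    intro k
    have h := hw _ (isCompact_closedBall 0 k)
    rw [dualMeasure, withDensity_apply _ Metric.isClosed_closedBall.measurableSet] at h
    filter_upwards [ae_lt_top' (hv.aemeasurable.pow_const _).restrict h.ne] with x hx h0
    rw [h0, ENNReal.zero_rpow_of_neg (by linarith)] at hx
    exact lt_irrefl _ hx
  have := ae_restrict_iUnion_iff (fun k : ℕ => Metric.closedBall (0 : Rn n) k)
    (fun x => ENNReal.ofReal (v x) ≠ 0) |>.2 key
  rwa [Metric.iUnion_closedBall_nat, Measure.restrict_univ] at this

/-- Hölder's inequality `|Q| ≤ v(Q)^{1/p} w(Q)^{1/p'}`. -/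
theorem volume_le_wMeasure_mul_dualMeasure {p : ℝ} (hp : 1 < p) {v : Rn n → ℝ} (hv : IsWeight v)
    (hw : ∀ K : Set (Rn n), IsCompact K → dualMeasure p v K < ∞) {Q : Set (Rn n)}
    (hQ : MeasurableSet Q) :
    volume Q ≤ wMeasure v Q ^ (1 / p) * dualMeasure p v Q ^ (1 / p.conjExponent) := by
  have hpp := Real.HolderConjugate.conjExponent hp
  have hp0 := hpp.pos
  have hp'0 := hpp.symm.pos
  have h := ENNReal.lintegral_mul_le_Lp_mul_Lq (volume.restrict Q) hpp
    (f := fun x => ENNReal.ofReal (v x) ^ (1 / p))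
    (g := fun x => ENNReal.ofReal (v x) ^ (-(1 / p)))
    (hv.aemeasurable.pow_const _).restrict (hv.aemeasurable.pow_const _).restrict
  simp only [← ENNReal.rpow_mul] at h
  have e1 : 1 / p * p = 1 := by field_simp
  have e2 : -(1 / p) * p.conjExponent = -(p.conjExponent / p) := by ring
  rw [e1, e2] at h
  simp only [ENNReal.rpow_one] at h
  rw [wMeasure, dualMeasure, withDensity_apply _ hQ, withDensity_apply _ hQ]
  refine le_trans (le_of_eq ?_) h
  rw [← setLIntegral_one]
  refine lintegral_congr_ae (ae_restrict_of_ae ?_)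
  filter_upwards [ae_ofReal_ne_zero_of_dualMeasure hp hv hw] with x hx
  simp only [Pi.mul_apply]
  rw [← ENNReal.rpow_add _ _ hx ENNReal.ofReal_ne_top, add_neg_cancel, ENNReal.rpow_zero]

/-! ### From comparability to the inequality for bounded sets -/

/-- An upper bound for the dual density is a lower bound for `v`. -/
theorem inv_rpow_mul_volume_le_wMeasure {p : ℝ} (hp : 1 < p) {v : Rn n → ℝ} {N : ℝ≥0∞}
    (h : ∀ᵐ x, ENNReal.ofReal (v x) ^ (-(p.conjExponent / p)) ≤ N ^ p.conjExponent)
    {F : Set (Rn n)} (hF : MeasurableSet F) :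
    N⁻¹ * volume F ^ (1 / p) ≤ wMeasure v F ^ (1 / p) := by
  have hpp := Real.HolderConjugate.conjExponent hp
  have hp0 := hpp.pos
  have hp'0 := hpp.symm.pos
  have hlow : ∀ᵐ x, N⁻¹ ^ p ≤ ENNReal.ofReal (v x) := by
    filter_upwards [h] with x hx
    have h1 := ENNReal.rpow_le_rpow hx (by positivity : 0 ≤ p / p.conjExponent)
    rw [← ENNReal.rpow_mul, ← ENNReal.rpow_mul] at h1
    have e1 : -(p.conjExponent / p) * (p / p.conjExponent) = -1 := by field_simp
    have e2 : p.conjExponent * (p / p.conjExponent) = p := by field_simp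
    rw [e1, e2, ENNReal.rpow_neg_one] at h1
    rw [ENNReal.inv_rpow]
    exact ENNReal.inv_le_iff_inv_le.1 h1
  have h2 : N⁻¹ ^ p * volume F ≤ wMeasure v F := by
    rw [wMeasure, withDensity_apply _ hF, ← setLIntegral_const]
    exact lintegral_mono_ae (ae_restrict_of_ae hlow)
  have h3 := ENNReal.rpow_le_rpow h2 (by positivity : 0 ≤ 1 / p)
  rwa [ENNReal.mul_rpow_of_nonneg _ _ (by positivity), ← ENNReal.rpow_mul,
    mul_one_div_cancel hp0.ne', ENNReal.rpow_one] at h3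

/-- Dividing by a power of the measure of a bounded set of positive measure. -/
theorem le_mul_rpow_neg_of_mul_rpow_le {F : Set (Rn n)} (hF : Bornology.IsBounded F)
    (hF0 : volume F ≠ 0) {b : ℝ} {X K V : ℝ≥0∞} (h : X * volume F ^ b ≤ K * V) :
    X ≤ K * volume F ^ (-b) * V := by
  have hFt : volume F ≠ ∞ := hF.measure_lt_top.ne
  calc X = X * volume F ^ b * volume F ^ (-b) := by
        rw [mul_assoc, ← ENNReal.rpow_add _ _ hF0 hFt, add_neg_cancel, ENNReal.rpow_zero, mul_one]
    _ ≤ K * V * volume F ^ (-b) := by gcongr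
    _ = _ := by ring

/-- The case `q ≤ p'`. If `u(E) > 0`, comparing `E` with large cubes `Q` bounds the averages of
`w` over small balls by a multiple of `|E| / u(E)^{p'/q}`, so that `v` is bounded below. -/
theorem exists_mul_le_of_comparableWith_volume (hn : 0 < n) {p q : ℝ} (hp : 1 < p) (hq : 1 < q)
    {u v : Rn n → ℝ} (hu : IsWeight u) (hv : IsWeight v)
    (hw : ∀ K : Set (Rn n), IsCompact K → dualMeasure p v K < ∞) (hN : NQ p q u v)
    (hcomp : ComparableWith (wMeasure u) volume (q / p.conjExponent)) :
    ∃ C : ℝ≥0, ∀ E F : Set (Rn n), MeasurableSet E → Bornology.IsBounded E → MeasurableSet F →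
      wMeasure u E ^ (1 / q) * volume F ^ (1 / p) ≤
        C * volume E ^ (1 / p.conjExponent) * wMeasure v F ^ (1 / p) := by
  obtain ⟨C, hC⟩ := hN.exists_closedBall hn hp hq
  obtain ⟨C₁, hC₁⟩ := hcomp
  obtain ⟨κ, hκ⟩ := exists_inv_volume_cube_le (n := n) hn
  have hp' : 0 < p.conjExponent := (Real.HolderConjugate.conjExponent hp).symm.pos
  have ha : 0 < 1 / p.conjExponent := by positivity
  have hb : 0 < 1 / q := by positivity
  have : IsLocallyFiniteMeasure (wMeasure u) := hu.isLocallyFiniteMeasure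
  have : IsLocallyFiniteMeasure (volume.withDensity fun x =>
      ENNReal.ofReal (v x) ^ (-(p.conjExponent / p))) := isLocallyFiniteMeasure_of_compact hw
  -- the summand `1` keeps the bound `L` below positive, so that it can be inverted
  set K : ℝ≥0 := C₁ ^ (1 / q) * C * κ ^ (1 / p.conjExponent) + 1 with hK
  refine ⟨K, fun E F hE hEb hF => ?_⟩
  rcases eq_or_ne (wMeasure u E) 0 with hE0 | hE0
  · rw [hE0, ENNReal.zero_rpow_of_pos hb, zero_mul]
    exact zero_le
  have hEt : wMeasure u E ≠ ∞ := hEb.measure_lt_top.ne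
  have hvE0 : volume E ≠ 0 := fun h => hE0 (withDensity_absolutelyContinuous _ _ h)
  have hvEt : volume E ≠ ∞ := hEb.measure_lt_top.ne
  set X := wMeasure u E ^ (1 / q) with hX
  set e := volume E ^ (1 / p.conjExponent) with he
  have hX0 : X ≠ 0 := by simp [hX, ENNReal.rpow_eq_zero_iff, hE0, hEt]
  have hXt : X ≠ ∞ := ENNReal.rpow_ne_top_of_nonneg hb.le hEt
  have he0 : e ≠ 0 := by simp [he, ENNReal.rpow_eq_zero_iff, hvE0, hvEt]
  have het : e ≠ ∞ := ENNReal.rpow_ne_top_of_nonneg ha.le hvEt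
  have hK0 : (K : ℝ≥0∞) ≠ 0 := by
    rw [ENNReal.coe_ne_zero, hK]
    positivity
  set L : ℝ≥0∞ := K * e * X⁻¹ with hL
  have hL0 : L ≠ 0 := mul_ne_zero (mul_ne_zero hK0 he0) (ENNReal.inv_ne_zero.2 hXt)
  have hLt : L ≠ ∞ :=
    ENNReal.mul_ne_top (ENNReal.mul_ne_top ENNReal.coe_ne_top het) (ENNReal.inv_ne_top.2 hX0)
  have hball : ∀ᶠ δ : ℝ in 𝓝[>] 0, ∀ τ : Rn n, dualMeasure p v (Metric.closedBall τ δ) ≤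
      L ^ p.conjExponent * volume (Metric.closedBall τ δ) := by
    filter_upwards [eventually_subset_cube hn hEb, self_mem_nhdsWithin] with δ hsub hδ τ
    have hδ : 0 < δ := hδ
    have hr : 0 < 1 / (n * δ) := by positivity
    have h1 := ENNReal.rpow_le_rpow (hC₁ 0 _ hr E hE hsub) hb.le
    have h2 := (hC 0 τ δ hδ).1
    have h3 := ENNReal.rpow_le_rpow (hκ 0 τ δ hδ) ha.le
    set Q : Set (Rn n) := cube 0 (1 / (n * δ))
    set B := Metric.closedBall τ δ
    have hQ0 : wMeasure u Q ^ (1 / q) ≠ 0 := by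
      have : wMeasure u Q ≠ 0 := fun h => hE0 (measure_mono_null hsub h)
      simp [ENNReal.rpow_eq_zero_iff, this, (by linarith : 0 ≤ q)]
    have hQt : wMeasure u Q ^ (1 / q) ≠ ∞ :=
      ENNReal.rpow_ne_top_of_nonneg hb.le (isBounded_cube _ _).measure_lt_top.ne
    rw [ENNReal.div_rpow_of_nonneg _ _ hb.le, ENNReal.mul_rpow_of_nonneg _ _ hb.le,
      ← ENNReal.rpow_mul, show q / p.conjExponent * (1 / q) = 1 / p.conjExponent by field_simp,
      ENNReal.div_rpow_of_nonneg _ _ ha.le, ENNReal.div_le_iff hQ0 hQt, ← hX, ← he,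
      div_eq_mul_inv e, ← ENNReal.inv_rpow] at h1
    rw [ENNReal.mul_rpow_of_nonneg _ _ ha.le] at h3
    refine (ENNReal.rpow_le_rpow_iff ha).1 ?_
    rw [ENNReal.mul_rpow_of_nonneg _ _ ha.le, ← ENNReal.rpow_mul, mul_one_div_cancel hp'.ne',
      ENNReal.rpow_one]
    set W := dualMeasure p v B ^ (1 / p.conjExponent)
    have hWX : W * X ≤ K * e * volume B ^ (1 / p.conjExponent) :=
      calc W * X ≤ W * ((C₁ : ℝ≥0∞) ^ (1 / q) * (e * (volume Q)⁻¹ ^ (1 / p.conjExponent)) *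
              wMeasure u Q ^ (1 / q)) := by gcongr
        _ = (C₁ : ℝ≥0∞) ^ (1 / q) * e * (volume Q)⁻¹ ^ (1 / p.conjExponent) *
              (wMeasure u Q ^ (1 / q) * W) := by ring
        _ ≤ (C₁ : ℝ≥0∞) ^ (1 / q) * e *
              ((κ : ℝ≥0∞) ^ (1 / p.conjExponent) * volume B ^ (1 / p.conjExponent)) * C := by
            gcongr
        _ = ((C₁ : ℝ≥0∞) ^ (1 / q) * C * (κ : ℝ≥0∞) ^ (1 / p.conjExponent)) * e *
              volume B ^ (1 / p.conjExponent) := by ring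
        _ ≤ K * e * volume B ^ (1 / p.conjExponent) := by
            gcongr
            rw [hK]
            push_cast [ENNReal.coe_rpow_of_nonneg _ hb.le, ENNReal.coe_rpow_of_nonneg _ ha.le]
            exact le_self_add
    calc W = W * X * X⁻¹ := by rw [mul_assoc, ENNReal.mul_inv_cancel hX0 hXt, mul_one]
      _ ≤ K * e * volume B ^ (1 / p.conjExponent) * X⁻¹ := by gcongr
      _ = L * volume B ^ (1 / p.conjExponent) := by rw [hL]; ring
  have hae := ae_le_of_eventually_closedBall_le (hv.aemeasurable.pow_const _) hball
  have h4 := inv_rpow_mul_volume_le_wMeasure hp hae hF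
  calc X * volume F ^ (1 / p) = X * (L * (L⁻¹ * volume F ^ (1 / p))) := by
        rw [← mul_assoc L, ENNReal.mul_inv_cancel hL0 hLt, one_mul]
    _ ≤ X * (L * wMeasure v F ^ (1 / p)) := by gcongr
    _ = (X * X⁻¹) * (K * e * wMeasure v F ^ (1 / p)) := by rw [hL]; ring
    _ = K * e * wMeasure v F ^ (1 / p) := by rw [ENNReal.mul_inv_cancel hX0 hXt, one_mul]

/-- The case `p' ≤ q`. Comparing `F` with large cubes `Q` and Hölder's inequality on `Q` bound the
averages of `u` over small balls by a multiple of `v(F)^{q/p} / |F|^{q/q'}`. -/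
theorem exists_mul_le_of_comparableWith_wMeasure (hn : 0 < n) {p q : ℝ} (hp : 1 < p) (hq : 1 < q)
    {u v : Rn n → ℝ} (hu : IsWeight u) (hv : IsWeight v)
    (hw : ∀ K : Set (Rn n), IsCompact K → dualMeasure p v K < ∞) (hN : NQ p q u v)
    (hcomp : ComparableWith volume (wMeasure v) (q.conjExponent / p)) :
    ∃ C : ℝ≥0, ∀ E F : Set (Rn n), MeasurableSet E → MeasurableSet F → Bornology.IsBounded F →
      volume F ≠ 0 →
      wMeasure u E ^ (1 / q) * volume F ^ (1 / q.conjExponent) ≤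
        C * volume E ^ (1 / q) * wMeasure v F ^ (1 / p) := by
  obtain ⟨C, hC⟩ := hN.exists_closedBall hn hp hq
  obtain ⟨C₁, hC₁⟩ := hcomp
  obtain ⟨κ, hκ⟩ := exists_inv_volume_cube_le (n := n) hn
  have hqq := Real.HolderConjugate.conjExponent hq
  have hq' : 0 < q.conjExponent := hqq.symm.pos
  have ha : 0 < 1 / q.conjExponent := by positivity
  have hb : 0 < 1 / q := by positivity
  have hc : 0 < 1 / p := by positivity
  have : IsLocallyFiniteMeasure (wMeasure v) := hv.isLocallyFiniteMeasure
  have : IsLocallyFiniteMeasure (volume.withDensity fun x => ENNReal.ofReal (u x)) :=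
    hu.isLocallyFiniteMeasure
  set K : ℝ≥0 := C₁ ^ (1 / q.conjExponent) * C * κ ^ (1 / q) with hK
  have hKcoe : (K : ℝ≥0∞) = (C₁ : ℝ≥0∞) ^ (1 / q.conjExponent) * C * (κ : ℝ≥0∞) ^ (1 / q) := by
    rw [hK]
    push_cast [ENNReal.coe_rpow_of_nonneg _ hb.le, ENNReal.coe_rpow_of_nonneg _ ha.le]
    rfl
  refine ⟨K, fun E F hE hF hFb hF0 => ?_⟩
  have hFt : volume F ≠ ∞ := hFb.measure_lt_top.ne
  set f := volume F ^ (1 / q.conjExponent) with hf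
  set V := wMeasure v F ^ (1 / p) with hV
  have hf0 : f ≠ 0 := by simp [hf, ENNReal.rpow_eq_zero_iff, hF0, hFt]
  have hft : f ≠ ∞ := ENNReal.rpow_ne_top_of_nonneg ha.le hFt
  set L : ℝ≥0∞ := K * V * f⁻¹ with hL
  have hball : ∀ᶠ δ : ℝ in 𝓝[>] 0, ∀ τ : Rn n,
      volume.withDensity (fun x => ENNReal.ofReal (u x)) (Metric.closedBall τ δ) ≤
      L ^ q * volume (Metric.closedBall τ δ) := by
    filter_upwards [eventually_subset_cube hn hFb, self_mem_nhdsWithin] with δ hsub hδ τ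
    have hδ : 0 < δ := hδ
    have hr : 0 < 1 / (n * δ) := by positivity
    have h1 := ENNReal.rpow_le_rpow (hC₁ 0 _ hr F hF hsub) ha.le
    have h2 := (hC 0 τ δ hδ).2
    have h3 := ENNReal.rpow_le_rpow (hκ 0 τ δ hδ) hb.le
    have h4 := volume_le_wMeasure_mul_dualMeasure hp hv hw (measurableSet_cube 0 (1 / (n * δ)))
    have hQ0 := volume_cube_ne_zero (0 : Rn n) hr
    have hQt : volume (cube (0 : Rn n) (1 / (n * δ))) ≠ ∞ :=
      (isBounded_cube _ _).measure_lt_top.ne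
    change wMeasure u _ ≤ _
    set Q : Set (Rn n) := cube 0 (1 / (n * δ))
    set B := Metric.closedBall τ δ
    have hvQ0 : wMeasure v Q ^ (1 / p) ≠ 0 := by
      intro h
      rw [h, zero_mul, nonpos_iff_eq_zero] at h4
      exact hQ0 h4
    have hvQt : wMeasure v Q ^ (1 / p) ≠ ∞ :=
      ENNReal.rpow_ne_top_of_nonneg hc.le (isBounded_cube _ _).measure_lt_top.ne
    have hQa0 : volume Q ^ (1 / q.conjExponent) ≠ 0 := by
      simp [ENNReal.rpow_eq_zero_iff, hQ0, hQt]
    have hQat : volume Q ^ (1 / q.conjExponent) ≠ ∞ :=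
      ENNReal.rpow_ne_top_of_nonneg ha.le hQt
    rw [ENNReal.div_rpow_of_nonneg _ _ ha.le, ENNReal.mul_rpow_of_nonneg _ _ ha.le,
      ← ENNReal.rpow_mul, show q.conjExponent / p * (1 / q.conjExponent) = 1 / p by field_simp,
      ENNReal.div_rpow_of_nonneg _ _ hc.le, ENNReal.div_le_iff hQa0 hQat, ← hf, ← hV] at h1
    rw [ENNReal.mul_rpow_of_nonneg _ _ hb.le] at h3
    refine (ENNReal.rpow_le_rpow_iff hb).1 ?_
    rw [ENNReal.mul_rpow_of_nonneg _ _ hb.le, ← ENNReal.rpow_mul,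
      mul_one_div_cancel (by linarith : q ≠ 0), ENNReal.rpow_one]
    set U := wMeasure u B ^ (1 / q)
    set y := wMeasure v Q ^ (1 / p)
    set W := dualMeasure p v Q ^ (1 / p.conjExponent)
    -- since `1/q' = 1 - 1/q`, Hölder's inequality bounds `|Q|^{1/q'} / v(Q)^{1/p}`
    have h5 : volume Q ^ (1 / q.conjExponent) * y⁻¹ ≤ (volume Q)⁻¹ ^ (1 / q) * W := by
      have e1 : volume Q ^ (1 / q.conjExponent) = (volume Q)⁻¹ ^ (1 / q) * volume Q := by
        rw [ENNReal.inv_rpow, ← ENNReal.rpow_neg]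
        conv_rhs => rw [← ENNReal.rpow_one (volume Q), ← ENNReal.rpow_mul, one_mul]
        rw [← ENNReal.rpow_add _ _ hQ0 hQt]
        congr 1
        have := hqq.inv_add_inv_eq_one
        rw [one_div, one_div]
        linarith
      rw [e1]
      calc (volume Q)⁻¹ ^ (1 / q) * volume Q * y⁻¹
          ≤ (volume Q)⁻¹ ^ (1 / q) * (y * W) * y⁻¹ := by gcongr
        _ = (y * y⁻¹) * ((volume Q)⁻¹ ^ (1 / q) * W) := by ring
        _ = _ := by rw [ENNReal.mul_inv_cancel hvQ0 hvQt, one_mul]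
    have hUf : U * f ≤ K * V * volume B ^ (1 / q) :=
      calc U * f ≤ U * ((C₁ : ℝ≥0∞) ^ (1 / q.conjExponent) * (V / y) *
              volume Q ^ (1 / q.conjExponent)) := by gcongr
        _ = (C₁ : ℝ≥0∞) ^ (1 / q.conjExponent) * V * U *
              (volume Q ^ (1 / q.conjExponent) * y⁻¹) := by rw [div_eq_mul_inv V]; ring
        _ ≤ (C₁ : ℝ≥0∞) ^ (1 / q.conjExponent) * V * U * ((volume Q)⁻¹ ^ (1 / q) * W) := by
            gcongr
        _ = (C₁ : ℝ≥0∞) ^ (1 / q.conjExponent) * V * (volume Q)⁻¹ ^ (1 / q) * (U * W) := by ring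
        _ ≤ (C₁ : ℝ≥0∞) ^ (1 / q.conjExponent) * V *
              ((κ : ℝ≥0∞) ^ (1 / q) * volume B ^ (1 / q)) * C := by gcongr
        _ = K * V * volume B ^ (1 / q) := by rw [hKcoe]; ring
    calc U = U * f * f⁻¹ := by rw [mul_assoc, ENNReal.mul_inv_cancel hf0 hft, mul_one]
      _ ≤ K * V * volume B ^ (1 / q) * f⁻¹ := by gcongr
      _ = L * volume B ^ (1 / q) := by rw [hL]; ring
  have hae := ae_le_of_eventually_closedBall_le hu.aemeasurable hball
  have hE' : wMeasure u E ^ (1 / q) ≤ L * volume E ^ (1 / q) := by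
    have h6 : wMeasure u E ≤ L ^ q * volume E := by
      rw [wMeasure, withDensity_apply _ hE, ← setLIntegral_const]
      exact lintegral_mono_ae (ae_restrict_of_ae hae)
    have h7 := ENNReal.rpow_le_rpow h6 hb.le
    rwa [ENNReal.mul_rpow_of_nonneg _ _ hb.le, ← ENNReal.rpow_mul,
      mul_one_div_cancel (by linarith : q ≠ 0), ENNReal.rpow_one] at h7
  calc wMeasure u E ^ (1 / q) * f ≤ L * volume E ^ (1 / q) * f := by gcongr
    _ = (f * f⁻¹) * (K * volume E ^ (1 / q) * V) := by rw [hL]; ring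
    _ = K * volume E ^ (1 / q) * V := by rw [ENNReal.mul_inv_cancel hf0 hft, one_mul]

end WeightedFourier

end

theorem theorem4 (n : ℕ) (hn : 0 < n) (p q : ℝ) (hp : 1 < p) (hq : 1 < q)
    (u v : WeightedFourier.Rn n → ℝ)
    (hu : WeightedFourier.IsWeight u) (hv : WeightedFourier.IsWeight v)
    -- `w = v^{-p'/p}` is locally integrable
    (hw : ∀ K : Set (WeightedFourier.Rn n), IsCompact K →
      WeightedFourier.dualMeasure p v K < ∞)
    (hN : WeightedFourier.NQ p q u v) :
    -- the comparability condition implies the inequality for bounded sets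
    (((q ≤ p.conjExponent ∧
          WeightedFourier.ComparableWith (WeightedFourier.wMeasure u) volume
            (q / p.conjExponent)) ∨
        (p.conjExponent ≤ q ∧
          WeightedFourier.ComparableWith volume (WeightedFourier.wMeasure v)
            (q.conjExponent / p))) →
      ∃ C : ℝ≥0, ∀ E F : Set (WeightedFourier.Rn n),
        MeasurableSet E → Bornology.IsBounded E → MeasurableSet F → Bornology.IsBounded F →
        volume F ≠ 0 →
        WeightedFourier.wMeasure u E ^ (1 / q) ≤
          C * volume E ^ (1 / max p.conjExponent q) *
            volume F ^ (-(1 / (max p.conjExponent q).conjExponent)) *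
            WeightedFourier.wMeasure v F ^ (1 / p)) ∧
    -- the inequality for bounded sets implies the restricted weak-type estimate
    ((∃ C : ℝ≥0, ∀ E F : Set (WeightedFourier.Rn n),
        MeasurableSet E → Bornology.IsBounded E → MeasurableSet F → Bornology.IsBounded F →
        volume F ≠ 0 →
        WeightedFourier.wMeasure u E ^ (1 / q) ≤
          C * volume E ^ (1 / max p.conjExponent q) *
            volume F ^ (-(1 / (max p.conjExponent q).conjExponent)) *
            WeightedFourier.wMeasure v F ^ (1 / p)) →
      2 ≤ max p.conjExponent q →
      ∃ T : Set (WeightedFourier.Rn n) → WeightedFourier.Rn n → ℂ,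
        WeightedFourier.ExtendsFourier q u v T ∧
        ∃ C : ℝ≥0, ∀ A : Set (WeightedFourier.Rn n), MeasurableSet A →
          WeightedFourier.wMeasure v A < ∞ → ∀ α : ℝ≥0, 0 < α →
          WeightedFourier.wMeasure u {z | (α : ℝ) < ‖T A z‖} ^ (1 / q) ≤
            ((C / α : ℝ≥0) : ℝ≥0∞) * WeightedFourier.wMeasure v A ^ (1 / p)) := by
  have hconj : ∀ {r : ℝ}, 1 < r → r.conjExponent.conjExponent = r := fun hr =>
    (Real.HolderConjugate.conjExponent hr).symm.conjExponent_eq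
  refine ⟨?_, fun ⟨C, hC⟩ hs => WeightedFourier.exists_extendsFourier hp hq hs hC⟩
  rintro (⟨hle, hcomp⟩ | ⟨hle, hcomp⟩)
  · obtain ⟨C, hC⟩ := WeightedFourier.exists_mul_le_of_comparableWith_volume hn hp hq hu hv hw hN
      hcomp
    refine ⟨C, fun E F hE hEb hF hFb hF0 => ?_⟩
    rw [max_eq_left hle, hconj hp]
    exact WeightedFourier.le_mul_rpow_neg_of_mul_rpow_le hFb hF0 (hC E F hE hEb hF)
  · obtain ⟨C, hC⟩ := WeightedFourier.exists_mul_le_of_comparableWith_wMeasure hn hp hq hu hv hw hN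
      hcomp
    refine ⟨C, fun E F hE _ hF hFb hF0 => ?_⟩
    rw [max_eq_right hle]
    exact WeightedFourier.le_mul_rpow_neg_of_mul_rpow_le hFb hF0 (hC E F hE hF hFb hF0)
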